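/- **Setting.** Fix a real $\alpha>1$ and integers $1\le D\le T$. A workload vector is $w=(w_0,\dots,w_{T-D})$ with $w_i\in\mathbb R_{\ge 0}$ (integer workloads are a special case); job $i$ is released at time $i$. For a real duration $L>0$, a feasible schedule for $(w,L,T)$ is a family of measurable functions $s_i:\mathbb R\to[0,\infty)$, vanishing outside $[i,i+L]$, with $\int_i^{i+L}s_i(t)\,dt=w_i$ for all $i$. Its energy is $\int_0^T\big(\sum_i s_i(t)\big)^\alpha dt$, and $\mathrm{OPT}(w,L,T)$ is the infimum of the energies of the feasible schedules for $(w,L,T)$. **Algorithm LAS**, with parameter $\varepsilon>0$, for Uniform Speed Scaling. The prediction $w^{\mathrm{pred}}$ is known in advance, and $w^{\mathrm{real}}_i$ is revealed at time $i$. Let $\delta\in(0,1)$ be given by $\left(\frac{1+\delta}{1-\delta}\right)^\alpha=1+\varepsilon$ and put $L=(1-\delta)D$. First compute an optimal schedule for $(w^{\mathrm{pred}},L,T)$ which is normalized: it runs each job $i$ at a uniform speed $c_i$ in an interval $[a_i,b_i]\subseteq[i,i+L]$, with $c_i(b_i-a_i)=w_i^{\mathrm{pred}}$, and the intervals have disjoint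 interiors. At time $i$ set $s'_i(t)=\min\{w^{\mathrm{real}}_i/(b_i-a_i),\,c_i\}$ for $t\in[a_i,b_i]$ and $s_i'(t)=0$ otherwise, where $s_i'=0$ if $a_i=b_i$; set $s''_i(t)=\frac1{L}\max\{0,\,w^{\mathrm{real}}_i-w^{\mathrm{pred}}_i\}$ for $t\in[i,i+L]$ and $s_i''(t)=0$ otherwise; and process job $i$ at speed $$s_i(t)=\frac1{\delta D}\int_{t-\delta D}^{t}\big(s'_i(r)+s''_i(r)\big)\,dr .$$ **Theorem.** For every $E>0$ there is a constant $C>0$, depending only on $E$, such that for all $\alpha>1$, all $0<\varepsilon\le E$, all integers $1\le D\le T$ and all workload vectors $w^{\mathrm{real}},w^{\mathrm{pred}}$ the following holds. A normalized optimal schedule for $(w^{\mathrm{pred}},(1-\delta)D,T)$ exists, and for every choice of it the schedule $(s_i)_i$ produced by LAS is feasible for $(w^{\mathrm{real}},D,T)$ and has energy at most $$\min\left\{(1+\varepsilon)\,\mathrm{OPT}+\left(\frac{C\alpha}{\varepsilon}\right)^{\alpha}\mathrm{err},\ \left(\frac{C\alpha}{\varepsilon}\right)^{\alpha}\mathrm{OPT}\right\},$$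 where $\mathrm{OPT}=\mathrm{OPT}(w^{\mathrm{real}},D,T)$ and $\mathrm{err}=\|w^{\mathrm{real}}-w^{\mathrm{pred}}\|_\alpha^\alpha=\sum_i|w^{\mathrm{real}}_i-w^{\mathrm{pred}}_i|^\alpha$. Thus LAS is at once consistent (energy at most $(1+\varepsilon)\mathrm{OPT}$ when $\mathrm{err}=0$), smooth (the first bound) and robust (the second bound, whatever the prediction). -/

import Mathlib

open MeasureTheory

namespace SpeedScaling

noncomputable section

/-- A family of speeds: `s i t` is the speed at which job `i` is processed at time `t`. -/
abbrev Schedule (n : ℕ) : Type := Fin n → ℝ → ℝ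

/-- `s` is a feasible schedule for the workloads `w` and the duration `L`. Job `i` is released at
time `i`, is processed only within `[i, i + L]`, and receives there the total amount `w i` of work.
The duration is a real number, since shortened durations `(1 - δ) * D` have to be considered. -/
structure IsFeasible {n : ℕ} (L : ℝ) (w : Fin n → ℝ) (s : Schedule n) : Prop where
  measurable : ∀ i : Fin n, Measurable (s i)
  nonneg : ∀ i t, 0 ≤ s i t
  eq_zero : ∀ (i : Fin n) (t : ℝ), t ∉ Set.Icc ((i : ℕ) : ℝ) (((i : ℕ) : ℝ) + L) → s i t = 0
  integrable : ∀ (i : Fin n), IntervalIntegrable (s i) volume ((i : ℕ) : ℝ) (((i : ℕ) : ℝ) + L)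
  work : ∀ (i : Fin n), ∫ t in ((i : ℕ) : ℝ)..(((i : ℕ) : ℝ) + L), s i t = w i

/-- The energy `∫_0^T s(t)^α dt` of a schedule, where `s(t) = ∑ i, s i t` is the total speed.
It is a Lebesgue integral with values in `[0, ∞]`. -/
def energy {n : ℕ} (α T : ℝ) (s : Schedule n) : ENNReal :=
  ∫⁻ t in Set.Icc (0 : ℝ) T, ENNReal.ofReal ((∑ i, s i t) ^ α)

/-- The optimal offline energy for the workloads `w`, the duration `L` and the horizon `[0, T]`. -/
def opt {n : ℕ} (α L T : ℝ) (w : Fin n → ℝ) : ENNReal :=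
  ⨅ (s : Schedule n) (_ : IsFeasible L w s), energy α T s

/-- The prediction error `‖wreal - wpred‖_α^α`. -/
def predErr {n : ℕ} (α : ℝ) (wreal wpred : Fin n → ℝ) : ℝ :=
  ∑ i, |wreal i - wpred i| ^ α

/-- Data of a schedule that runs each job `i` at the uniform speed `c i` during `[a i, b i]`. -/
structure Plan (n : ℕ) where
  a : Fin n → ℝ
  b : Fin n → ℝ
  c : Fin n → ℝ

/-- The schedule described by a plan. -/
def Plan.schedule {n : ℕ} (p : Plan n) : Schedule n :=
  fun i t => (Set.Icc (p.a i) (p.b i)).indicator (fun _ => p.c i) t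

/-- `p` describes a normalized optimal schedule for the workloads `w`, the duration `L` and the
horizon `[0, T]`: each job runs at a uniform speed in one interval inside its window, the intervals
do not overlap, and the schedule is feasible and of minimal energy. (The interval of a job without
work may be a single point.) -/
structure IsNormalizedOptimal {n : ℕ} (α L T : ℝ) (w : Fin n → ℝ) (p : Plan n) : Prop where
  le_start : ∀ (i : Fin n), ((i : ℕ) : ℝ) ≤ p.a i
  start_le_end : ∀ i, p.a i ≤ p.b i
  end_le : ∀ (i : Fin n), p.b i ≤ ((i : ℕ) : ℝ) + L
  nonoverlapping : ∀ i j, i ≠ j → Disjoint (Set.Ioo (p.a i) (p.b i)) (Set.Ioo (p.a j) (p.b j))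
  feasible : IsFeasible L w p.schedule
  optimal : energy α T p.schedule = opt α L T w

/-- The algorithm LAS-Trust for duration `L`: the speed at time `t` of a job released at time `r`,
with actual workload `x` and predicted workload `y`, planned at speed `c` during `[a, b]`.
The job runs at uniform speed, capped at `c`, in `[a, b]`; the work exceeding the
prediction is spread uniformly over `[r, r + L]`. -/
def trustSpeed (L r a b c x y : ℝ) (t : ℝ) : ℝ :=
  (Set.Icc a b).indicator (fun _ => min (x / (b - a)) c) t
    + (Set.Icc r (r + L)).indicator (fun _ => max 0 (x - y) / L) t

/-- The convolution operator with window length `h`. -/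
def convolve (h : ℝ) (f : ℝ → ℝ) (t : ℝ) : ℝ :=
  (1 / h) * ∫ r in (t - h)..t, f r

/-- The parameter `δ` that LAS uses. See `lasDelta_spec` for its defining equation. -/
def lasDelta (α ε : ℝ) : ℝ :=
  ((1 + ε) ^ (1 / α) - 1) / ((1 + ε) ^ (1 / α) + 1)

theorem lasDelta_spec {α ε : ℝ} (hα : 1 < α) (hε : 0 < ε) :
    0 < lasDelta α ε ∧ lasDelta α ε < 1 ∧
      ((1 + lasDelta α ε) / (1 - lasDelta α ε)) ^ α = 1 + ε := by
  have hx : 1 < (1 + ε) ^ (1 / α) := Real.one_lt_rpow (by linarith) (by positivity)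
  have hpow : ((1 + ε) ^ (1 / α)) ^ α = 1 + ε := by
    rw [← Real.rpow_mul (by linarith), one_div_mul_cancel (by linarith), Real.rpow_one]
  unfold lasDelta
  generalize (1 + ε) ^ (1 / α) = x at hx hpow
  have h1 : 0 < x + 1 := by linarith
  have h2 : (1 + (x - 1) / (x + 1)) / (1 - (x - 1) / (x + 1)) = x := by
    have e1 : 1 + (x - 1) / (x + 1) = 2 * x / (x + 1) := by field_simp; ring
    have e2 : 1 - (x - 1) / (x + 1) = 2 / (x + 1) := by field_simp; ring
    rw [e1, e2]
    field_simp
  refine ⟨div_pos (by linarith) h1, (div_lt_one h1).2 (by linarith), ?_⟩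
  rw [h2, hpow]

/-- The algorithm LAS with parameter `ε`, duration `D` and predicted workloads `wpred`, where `p` is
the normalized optimal plan for `wpred` with duration `(1 - δ) * D` that was computed beforehand:
LAS-Trust is run with duration `(1 - δ) * D`, and the speed of each job is convolved with window
length `δ * D`. The algorithm is online: the speed of job `i` depends on the actual workloads only
through `wreal i`, which is revealed at time `i`. -/
def las {n : ℕ} (α ε D : ℝ) (wpred : Fin n → ℝ) (p : Plan n) (wreal : Fin n → ℝ) : Schedule n :=
  fun i => convolve (lasDelta α ε * D)
    (trustSpeed ((1 - lasDelta α ε) * D) ((i : ℕ) : ℝ) (p.a i) (p.b i) (p.c i) (wreal i) (wpred i))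

end

end SpeedScaling

/-!
All energies are treated as integrals over `ℝ` of `(∑ i, s i t) ^ α` with values in `[0, ∞]`; this
is legitimate because the windows lie in `[0, T]` (`IsFeasible.energy_eq`).

*Normalized optimal schedules exist.* Because all windows have the same length, the total speed of
a feasible schedule may be spent on the jobs in the order of release without violating a deadline
(`IsFeasible.exists_orderedTimes`). By Jensen's inequality it is then best to run each job at
uniform speed in its interval (`IsFeasible.exists_orderedCost_le`). So the optimum is the minimum,
over the compact set of admissible start and end times, of a cost that is continuous with values in
`[0, ∞]`, and it is attained (`exists_isNormalizedOptimal`).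

*Feasibility.* LAS-Trust does `min (wreal i) (wpred i)` of job `i` along the plan and the rest
uniformly, so it is feasible for the duration `(1 - δ) * D`
(`IsNormalizedOptimal.trust_isFeasible`). Convolution preserves the work and lengthens the windows
by `δ * D` (`IsFeasible.convolve`).

*Consistency and smoothness.* Convolution does not increase the energy, by Jensen's inequality
(`IsFeasible.lintegral_convolve_le`). The speed of LAS-Trust is at most the planned speed plus the
errors spread over windows. As at most `D` windows overlap, the spread errors have energy at most
`(1 - δ) ^ (1 - α) * err` (`lintegral_error_rpow_le`). The planned energy is compared with the
optimum for `wreal` in two steps (`IsFeasible.opt_mul_le_of_workload`): changing the workloads again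
adds the spread errors, and shortening the windows costs a factor `(1 - δ) ^ (1 - α)`
(`IsFeasible.opt_mul_le`). Powers of sums are separated by convexity with the weights `1 - δ / 4`
and `δ / 4`. The resulting factor of the optimum stays below `((1 + δ) / (1 - δ)) ^ α = 1 + ε`,
and `1 / (δ * (1 - δ))` is of order `α / ε` (`one_div_lasDelta_le`).

*Robustness.* A convolved speed is at most `wreal i / (δ * D)`. Any feasible schedule does the work
of all jobs active at time `t` within `[t - D, t + D]`, so the speed of LAS is at most `2 / δ` times
an average of the speed of that schedule; Jensen's inequality again gives the factor `(2 / δ) ^ α`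
(`IsFeasible.lintegral_convolve_le_of_isFeasible`).
-/

namespace SpeedScaling

open Set ENNReal

/-! ### Jensen's inequality and moving averages -/

theorem rpow_setLIntegral_le {α : ℝ} (hα : 1 < α) {g : ℝ → ENNReal} (hg : Measurable g)
    (A : Set ℝ) :
    (∫⁻ t in A, g t) ^ α ≤ volume A ^ (α - 1) * ∫⁻ t in A, g t ^ α := by
  have hpq : α.HolderConjugate (α / (α - 1)) := Real.HolderConjugate.conjExponent hα
  have h := ENNReal.lintegral_mul_le_Lp_mul_Lq (volume.restrict A) hpq
    hg.aemeasurable (aemeasurable_const (b := (1 : ENNReal)))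
  simp only [Pi.mul_apply, mul_one, ENNReal.one_rpow, lintegral_const, one_mul,
    Measure.restrict_apply_univ] at h
  have h0 : 0 < α := by linarith
  calc (∫⁻ t in A, g t) ^ α
      ≤ ((∫⁻ t in A, g t ^ α) ^ (1 / α) * volume A ^ (1 / (α / (α - 1)))) ^ α :=
        ENNReal.rpow_le_rpow h h0.le
    _ = _ := by
        rw [ENNReal.mul_rpow_of_nonneg _ _ h0.le, ← ENNReal.rpow_mul, ← ENNReal.rpow_mul,
          one_div_mul_cancel h0.ne', ENNReal.rpow_one, mul_comm]
        congr 2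
        field_simp

/-- Processing a given amount of work in a set of given measure is cheapest at uniform speed. A set
of measure zero is not excluded: then the integral vanishes, and the left-hand side is zero. -/
theorem rpow_mul_rpow_le_setLIntegral {α : ℝ} (hα : 1 < α) {g : ℝ → ENNReal} (hg : Measurable g)
    {A : Set ℝ} (hA : volume A ≠ ⊤) :
    (∫⁻ t in A, g t) ^ α * volume A ^ (1 - α) ≤ ∫⁻ t in A, g t ^ α := by
  by_cases h0 : volume A = 0
  · rw [Measure.restrict_eq_zero.2 h0]
    simp [ENNReal.zero_rpow_of_pos (by linarith : 0 < α)]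
  · calc (∫⁻ t in A, g t) ^ α * volume A ^ (1 - α)
        ≤ (volume A ^ (α - 1) * ∫⁻ t in A, g t ^ α) * volume A ^ (1 - α) := by
          gcongr
          exact rpow_setLIntegral_le hα hg A
      _ = (volume A ^ (α - 1) * volume A ^ (1 - α)) * ∫⁻ t in A, g t ^ α := by ring
      _ = _ := by
          rw [← ENNReal.rpow_add _ _ h0 hA]
          simp

/-- Average of `g` over the window of length `h` that ends at `t`: the extended nonnegative
counterpart of `convolve`. -/
noncomputable def movingAverage (h : ℝ) (g : ℝ → ENNReal) (t : ℝ) : ENNReal :=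
  (ENNReal.ofReal h)⁻¹ * ∫⁻ r in Ioc (t - h) t, g r

theorem sum_movingAverage {ι : Type*} (s : Finset ι) (h : ℝ) {g : ι → ℝ → ENNReal}
    (hg : ∀ i, Measurable (g i)) (t : ℝ) :
    ∑ i ∈ s, movingAverage h (g i) t = movingAverage h (fun t => ∑ i ∈ s, g i t) t := by
  unfold movingAverage
  rw [lintegral_finsetSum _ fun i _ => hg i, Finset.mul_sum]

theorem lintegral_movingAverage {h : ℝ} (hh : 0 < h) {g : ℝ → ENNReal} (hg : Measurable g) :
    ∫⁻ t, movingAverage h g t = ∫⁻ t, g t := by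
  have hswap : ∀ t r : ℝ, (Ioc (t - h) t).indicator g r
      = (Ico r (r + h)).indicator (fun _ => g r) t := by
    intro t r
    simp only [indicator, mem_Ioc, mem_Ico]
    congr 1
    exact propext ⟨fun H => ⟨H.2, by linarith [H.1]⟩, fun H => ⟨by linarith [H.2], H.1⟩⟩
  have hmeas : Measurable (Function.uncurry fun t r : ℝ => (Ioc (t - h) t).indicator g r) := by
    have : (Function.uncurry fun t r : ℝ => (Ioc (t - h) t).indicator g r)
        = {x : ℝ × ℝ | x.1 - h < x.2 ∧ x.2 ≤ x.1}.indicator fun x => g x.2 := by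
      ext ⟨t, r⟩
      simp [indicator, Function.uncurry]
    rw [this]
    exact (hg.comp measurable_snd).indicator
      ((measurableSet_lt (measurable_fst.sub_const h) measurable_snd).inter
        (measurableSet_le measurable_snd measurable_fst))
  unfold movingAverage
  simp_rw [← lintegral_indicator measurableSet_Ioc]
  rw [lintegral_const_mul']
  · rw [lintegral_lintegral_swap hmeas.aemeasurable]
    simp_rw [hswap, lintegral_indicator_const measurableSet_Ico, Real.volume_Ico,
      add_sub_cancel_left]
    rw [lintegral_mul_const _ hg, mul_comm, mul_assoc, ENNReal.mul_inv_cancel, mul_one]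
    · simpa using hh
    · exact ENNReal.ofReal_ne_top
  · simpa using hh

theorem movingAverage_rpow_le {α : ℝ} (hα : 1 < α) {h : ℝ} (hh : 0 < h) {g : ℝ → ENNReal}
    (hg : Measurable g) (t : ℝ) :
    movingAverage h g t ^ α ≤ movingAverage h (fun r => g r ^ α) t := by
  have h0 : ENNReal.ofReal h ≠ 0 := by simpa using hh
  have hJ := rpow_setLIntegral_le hα hg (Ioc (t - h) t)
  rw [Real.volume_Ioc, _root_.sub_sub_cancel] at hJ
  unfold movingAverage
  rw [ENNReal.mul_rpow_of_nonneg _ _ (by linarith)]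
  calc _ ≤ (ENNReal.ofReal h)⁻¹ ^ α *
        (ENNReal.ofReal h ^ (α - 1) * ∫⁻ r in Ioc (t - h) t, g r ^ α) := by gcongr
    _ = _ := by
        rw [← mul_assoc, ENNReal.inv_rpow, ← ENNReal.rpow_neg,
          ← ENNReal.rpow_add _ _ h0 ENNReal.ofReal_ne_top, ← ENNReal.rpow_neg_one]
        congr 2
        ring

/-- Convolution with a window does not increase the energy. -/
theorem lintegral_movingAverage_rpow_le {α : ℝ} (hα : 1 < α) {h : ℝ} (hh : 0 < h)
    {g : ℝ → ENNReal} (hg : Measurable g) :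
    ∫⁻ t, movingAverage h g t ^ α ≤ ∫⁻ t, g t ^ α :=
  calc _ ≤ ∫⁻ t, movingAverage h (fun r => g r ^ α) t :=
        lintegral_mono fun t => movingAverage_rpow_le hα hh hg t
    _ = _ := lintegral_movingAverage hh (hg.pow_const α)

theorem ofReal_convolve {h : ℝ} (hh : 0 < h) {f : ℝ → ℝ} (h0 : ∀ t, 0 ≤ f t)
    (hf : Integrable f) (t : ℝ) :
    ENNReal.ofReal (convolve h f t) = movingAverage h (fun r => ENNReal.ofReal (f r)) t := by
  unfold convolve movingAverage
  rw [ENNReal.ofReal_mul (by positivity), one_div, ENNReal.ofReal_inv_of_pos hh,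
    intervalIntegral.integral_of_le (by linarith),
    ofReal_integral_eq_lintegral_ofReal hf.restrict (ae_of_all _ h0)]

/-! ### Powers of sums -/

/-- Convexity of `x ^ α`, with the weights `lam` and `mu`. -/
theorem add_rpow_le_of_weights {α : ℝ} (hα : 1 < α) {lam mu : ℝ} (hl : 0 < lam) (hm : 0 < mu)
    (hlm : lam + mu = 1) (x y : ENNReal) :
    (x + y) ^ α ≤ ENNReal.ofReal lam ^ (1 - α) * x ^ α + ENNReal.ofReal mu ^ (1 - α) * y ^ α := by
  have key : ∀ {c : ℝ}, 0 < c → ∀ z : ENNReal,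
      ENNReal.ofReal c * ((ENNReal.ofReal c)⁻¹ * z) = z ∧
      ENNReal.ofReal c * ((ENNReal.ofReal c)⁻¹ * z) ^ α
        = ENNReal.ofReal c ^ (1 - α) * z ^ α := by
    intro c hc z
    have h0 : ENNReal.ofReal c ≠ 0 := by simpa using hc
    constructor
    · rw [← mul_assoc, ENNReal.mul_inv_cancel h0 ENNReal.ofReal_ne_top, one_mul]
    · rw [ENNReal.mul_rpow_of_nonneg _ _ (by linarith), ENNReal.inv_rpow, ← ENNReal.rpow_neg,
        ← mul_assoc, sub_eq_add_neg, ENNReal.rpow_add _ _ h0 ENNReal.ofReal_ne_top,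
        ENNReal.rpow_one]
  have h := ENNReal.rpow_arith_mean_le_arith_mean2_rpow (ENNReal.ofReal lam) (ENNReal.ofReal mu)
    ((ENNReal.ofReal lam)⁻¹ * x) ((ENNReal.ofReal mu)⁻¹ * y)
    (by rw [← ENNReal.ofReal_add hl.le hm.le, hlm, ENNReal.ofReal_one]) hα.le
  rwa [(key hl x).1, (key hm y).1, (key hl x).2, (key hm y).2] at h

theorem lintegral_add_rpow_le {α : ℝ} (hα : 1 < α) {lam mu : ℝ} (hl : 0 < lam) (hm : 0 < mu)
    (hlm : lam + mu = 1) {f g : ℝ → ENNReal} (hf : Measurable f) (hg : Measurable g) :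
    ∫⁻ t, (f t + g t) ^ α ≤ ENNReal.ofReal lam ^ (1 - α) * (∫⁻ t, f t ^ α)
      + ENNReal.ofReal mu ^ (1 - α) * ∫⁻ t, g t ^ α := by
  rw [← lintegral_const_mul _ (hf.pow_const α), ← lintegral_const_mul _ (hg.pow_const α),
    ← lintegral_add_left ((hf.pow_const α).const_mul _)]
  exact lintegral_mono fun t => add_rpow_le_of_weights hα hl hm hlm _ _

/-- If at most one summand is nonzero, the power of the sum is the sum of the powers. -/
theorem sum_rpow_of_unique {ι : Type*} [Fintype ι] {α : ℝ} (hα : 0 < α) (x : ι → ENNReal)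
    (hx : ∀ i j, x i ≠ 0 → x j ≠ 0 → i = j) : (∑ i, x i) ^ α = ∑ i, x i ^ α := by
  classical
  by_cases h : ∃ i, x i ≠ 0
  · obtain ⟨i, hi⟩ := h
    have hz : ∀ j ≠ i, x j = 0 := fun j hj => by
      by_contra H
      exact hj (hx j i H hi)
    rw [Fintype.sum_eq_single i hz, Fintype.sum_eq_single i]
    intro j hj
    rw [hz j hj, ENNReal.zero_rpow_of_pos hα]
  · push Not at h
    simp [h, ENNReal.zero_rpow_of_pos hα]

/-- Release times are distinct integers, so at most `D` windows `[i, i + L)` with `L ≤ D` contain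
a given time, and the power mean inequality applies to `D` summands. -/
theorem lintegral_sum_window_rpow_le {n D : ℕ} {α : ℝ} (hα : 1 < α) {L : ℝ} (hLD : L ≤ D)
    (x : Fin n → ENNReal) :
    ∫⁻ t, (∑ i : Fin n, (Icc ((i : ℕ) : ℝ) (((i : ℕ) : ℝ) + L)).indicator (fun _ => x i) t) ^ α
      ≤ (D : ENNReal) ^ (α - 1) * ENNReal.ofReal L * ∑ i, x i ^ α := by
  classical
  have hα0 : 0 < α := by linarith
  have hae : ∀ i : Fin n,
      (Icc ((i : ℕ) : ℝ) (((i : ℕ) : ℝ) + L)).indicator (fun _ => x i) =ᵐ[volume]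
        (Ico ((i : ℕ) : ℝ) (((i : ℕ) : ℝ) + L)).indicator (fun _ => x i) := fun i =>
    indicator_ae_eq_of_ae_eq_set Ico_ae_eq_Icc.symm
  have hpt : ∀ t : ℝ,
      (∑ i : Fin n, (Ico ((i : ℕ) : ℝ) (((i : ℕ) : ℝ) + L)).indicator (fun _ => x i) t) ^ α
        ≤ (D : ENNReal) ^ (α - 1) *
          ∑ i : Fin n, (Ico ((i : ℕ) : ℝ) (((i : ℕ) : ℝ) + L)).indicator (fun _ => x i ^ α) t := by
    intro t
    set A : Finset (Fin n) :=
      Finset.univ.filter fun i => t ∈ Ico ((i : ℕ) : ℝ) (((i : ℕ) : ℝ) + L) with hA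
    have hsum : ∀ y : Fin n → ENNReal,
        ∑ i : Fin n, (Ico ((i : ℕ) : ℝ) (((i : ℕ) : ℝ) + L)).indicator (fun _ => y i) t
          = ∑ i ∈ A, y i := by
      intro y
      rw [hA, Finset.sum_filter]
      exact Finset.sum_congr rfl fun i _ => by simp only [indicator]
    have hcard : A.card ≤ D := by
      have : A.card ≤ (Finset.Ioc (⌊t⌋ - (D : ℤ)) ⌊t⌋).card := by
        refine Finset.card_le_card_of_injOn (fun i => ((i : ℕ) : ℤ)) ?_ ?_
        · intro i hi
          have hi' : t ∈ Ico ((i : ℕ) : ℝ) (((i : ℕ) : ℝ) + L) := by simpa [hA] using hi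
          simp only [Finset.coe_Ioc, mem_Ioc]
          constructor
          · have : ⌊t⌋ < ((i : ℕ) : ℤ) + (D : ℤ) := by
              rw [Int.floor_lt]
              push_cast
              linarith [hi'.2]
            linarith
          · rw [Int.le_floor]
            exact_mod_cast hi'.1
        · intro i _ j _ hij
          simpa [Fin.ext_iff] using hij
      simpa using this
    rw [hsum, hsum]
    refine (ENNReal.rpow_sum_le_const_mul_sum_rpow A x hα.le).trans ?_
    gcongr
  calc _ = ∫⁻ t, (∑ i : Fin n,
          (Ico ((i : ℕ) : ℝ) (((i : ℕ) : ℝ) + L)).indicator (fun _ => x i) t) ^ α := by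
        refine lintegral_congr_ae ?_
        filter_upwards [eventually_countable_forall.2 hae] with t ht
        simp_rw [ht]
    _ ≤ ∫⁻ t, (D : ENNReal) ^ (α - 1) * ∑ i : Fin n,
          (Ico ((i : ℕ) : ℝ) (((i : ℕ) : ℝ) + L)).indicator (fun _ => x i ^ α) t :=
        lintegral_mono hpt
    _ = _ := by
        rw [lintegral_const_mul, lintegral_finsetSum]
        · simp_rw [lintegral_indicator_const measurableSet_Ico, Real.volume_Ico,
            add_sub_cancel_left]
          rw [← Finset.sum_mul]
          ring
        · exact fun i _ => measurable_const.indicator measurableSet_Ico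
        · exact Finset.measurable_sum _ fun i _ => measurable_const.indicator measurableSet_Ico

/-! ### Feasible schedules -/

section Feasible

variable {n : ℕ} {L : ℝ} {w : Fin n → ℝ} {s : Schedule n}

theorem IsFeasible.integrable_line (hs : IsFeasible L w s) (hL : 0 ≤ L) (i : Fin n) :
    Integrable (s i) := by
  have h1 : IntegrableOn (s i) (Icc ((i : ℕ) : ℝ) (((i : ℕ) : ℝ) + L)) :=
    (intervalIntegrable_iff_integrableOn_Icc_of_le (by linarith)).1 (hs.integrable i)
  exact (integrableOn_iff_integrable_of_support_subset fun t ht => by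
    by_contra h
    exact ht (hs.eq_zero i t h)).1 h1

theorem IsFeasible.integral_eq (hs : IsFeasible L w s) (hL : 0 ≤ L) (i : Fin n) :
    ∫ t, s i t = w i := by
  rw [← hs.work i, intervalIntegral.integral_of_le (by linarith), ← integral_Icc_eq_integral_Ioc]
  exact (setIntegral_eq_integral_of_forall_compl_eq_zero fun t ht => hs.eq_zero i t ht).symm

theorem IsFeasible.lintegral_eq (hs : IsFeasible L w s) (hL : 0 ≤ L) (i : Fin n) :
    ∫⁻ t, ENNReal.ofReal (s i t) = ENNReal.ofReal (w i) := by
  rw [← hs.integral_eq hL i,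
    ofReal_integral_eq_lintegral_ofReal (hs.integrable_line hL i) (ae_of_all _ (hs.nonneg i))]

theorem IsFeasible.workload_nonneg (hs : IsFeasible L w s) (hL : 0 ≤ L) (i : Fin n) :
    0 ≤ w i := by
  rw [← hs.integral_eq hL i]
  exact integral_nonneg (hs.nonneg i)

/-- A criterion for feasibility in terms of integrals over the whole line. -/
theorem IsFeasible.of_lintegral (hL : 0 ≤ L) (hw : ∀ i, 0 ≤ w i) (hm : ∀ i, Measurable (s i))
    (h0 : ∀ i t, 0 ≤ s i t)
    (hz : ∀ (i : Fin n) (t : ℝ), t ∉ Icc ((i : ℕ) : ℝ) (((i : ℕ) : ℝ) + L) → s i t = 0)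
    (hI : ∀ i, ∫⁻ t, ENNReal.ofReal (s i t) = ENNReal.ofReal (w i)) : IsFeasible L w s := by
  have hint : ∀ i, Integrable (s i) := fun i => by
    refine ⟨(hm i).aestronglyMeasurable, ?_⟩
    rw [hasFiniteIntegral_iff_ofReal (ae_of_all _ (h0 i)), hI i]
    exact ENNReal.ofReal_lt_top
  refine ⟨hm, h0, hz, fun i => (hint i).intervalIntegrable, fun i => ?_⟩
  rw [intervalIntegral.integral_of_le (by linarith), ← integral_Icc_eq_integral_Ioc,
    setIntegral_eq_integral_of_forall_compl_eq_zero fun t ht => hz i t ht,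
    integral_eq_lintegral_of_nonneg_ae (ae_of_all _ (h0 i)) (hm i).aestronglyMeasurable, hI i,
    ENNReal.toReal_ofReal (hw i)]

/-- The horizon `[0, T]` contains all windows, so the energy is an integral over the whole line. -/
theorem IsFeasible.energy_eq (hs : IsFeasible L w s) {α T : ℝ} (hα : 0 < α)
    (hT : ∀ i : Fin n, ((i : ℕ) : ℝ) + L ≤ T) :
    energy α T s = ∫⁻ t, (∑ i, ENNReal.ofReal (s i t)) ^ α := by
  unfold energy
  rw [← lintegral_indicator measurableSet_Icc]
  refine lintegral_congr fun t => ?_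
  by_cases ht : t ∈ Icc (0 : ℝ) T
  · rw [indicator_of_mem ht, ← ENNReal.ofReal_rpow_of_nonneg
      (Finset.sum_nonneg fun i _ => hs.nonneg i t) hα.le,
      ENNReal.ofReal_sum_of_nonneg fun i _ => hs.nonneg i t]
  · rw [indicator_of_notMem ht]
    have : ∀ i, s i t = 0 := fun i => hs.eq_zero i t fun h =>
      ht ⟨(Nat.cast_nonneg _).trans h.1, h.2.trans (hT i)⟩
    simp [this, ENNReal.zero_rpow_of_pos hα]

theorem IsFeasible.measurable_ofReal (hs : IsFeasible L w s) (i : Fin n) :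
    Measurable fun t => ENNReal.ofReal (s i t) :=
  (hs.measurable i).ennreal_ofReal

theorem IsFeasible.measurable_total (hs : IsFeasible L w s) :
    Measurable fun t => ∑ i, ENNReal.ofReal (s i t) :=
  Finset.measurable_sum _ fun i _ => hs.measurable_ofReal i

theorem IsFeasible.opt_le (hs : IsFeasible L w s) (α T : ℝ) : opt α L T w ≤ energy α T s :=
  iInf₂_le s hs

end Feasible

/-! ### First-in-first-out schedules -/

/-- Start and end times of the jobs in a schedule that processes the jobs in the order of release,
each in one interval inside its window. -/
def orderedTimes (n : ℕ) (L : ℝ) : Set ((Fin n → ℝ) × (Fin n → ℝ)) :=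
  {x | (∀ i : Fin n, ((i : ℕ) : ℝ) ≤ x.1 i ∧ x.1 i ≤ x.2 i ∧ x.2 i ≤ ((i : ℕ) : ℝ) + L) ∧
    ∀ i j, i < j → x.2 i ≤ x.1 j}

/-- The energy needed to process each job at uniform speed between the given start and end times.
The cost is infinite as soon as a job with positive workload gets an interval of length zero. -/
noncomputable def orderedCost {n : ℕ} (α : ℝ) (w : Fin n → ℝ) (x : (Fin n → ℝ) × (Fin n → ℝ)) :
    ENNReal :=
  ∑ i, ENNReal.ofReal (w i) ^ α * ENNReal.ofReal (x.2 i - x.1 i) ^ (1 - α)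

/-- The plan with the given start and end times. The speed of a job whose interval is a single
point is zero, by the convention for division by zero. -/
noncomputable def uniformPlan {n : ℕ} (w : Fin n → ℝ) (x : (Fin n → ℝ) × (Fin n → ℝ)) : Plan n :=
  ⟨x.1, x.2, fun i => w i / (x.2 i - x.1 i)⟩

/-- If a monotone function takes the value `y` at `τ`, and its values at the ends of an interval
enclose `y`, then it also takes the value `y` at the point of the interval nearest to `τ`. -/
theorem apply_clamp_eq_of_monotone {F : ℝ → ℝ} (hF : Monotone F) {l u τ y : ℝ} (hl : F l ≤ y)
    (hu : y ≤ F u) (hτ : F τ = y) (hlu : l ≤ u) : F (max l (min u τ)) = y := by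
  rcases le_total τ l with h | h
  · rw [min_eq_right (h.trans hlu), max_eq_left h]
    exact le_antisymm hl (hτ ▸ hF h)
  · rcases le_total τ u with h' | h'
    · rw [min_eq_right h', max_eq_right h, hτ]
    · rw [min_eq_left h', max_eq_right hlu]
      exact le_antisymm (hτ ▸ hF h') hu

section Fifo

variable {n : ℕ} {L : ℝ} {w : Fin n → ℝ} {s : Schedule n}

/-- Processing the same total speed in the order of release keeps all deadlines, because the
windows have a common length: start and end times can be found between which the total speed
accounts for exactly the workload of each job. -/
theorem IsFeasible.exists_orderedTimes (hs : IsFeasible L w s) (hL : 0 ≤ L) :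
    ∃ x ∈ orderedTimes n L, ∀ i,
      ∫⁻ t in Ioc (x.1 i) (x.2 i), ∑ j, ENNReal.ofReal (s j t) = ENNReal.ofReal (w i) := by
  have hint := hs.integrable_line hL
  -- `F t` is the total work done until `t`, and `W k` the total workload of the jobs before `k`.
  set F : ℝ → ℝ := fun t => ∑ j, ∫ r in Iic t, s j r with hF
  set W : ℕ → ℝ := fun k => ∑ j : Fin n, if (j : ℕ) < k then w j else 0 with hW
  have hw := hs.workload_nonneg hL
  have hdiff : ∀ a b : ℝ, F b - F a = ∫ r in a..b, ∑ j, s j r := fun a b => by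
    rw [hF, ← Finset.sum_sub_distrib, intervalIntegral.integral_finsetSum
      fun j _ => (hint j).intervalIntegrable]
    exact Finset.sum_congr rfl fun j _ =>
      intervalIntegral.integral_Iic_sub_Iic (hint j).integrableOn (hint j).integrableOn
  have hFcont : Continuous F := by
    have : F = fun t => F 0 + ∫ r in (0 : ℝ)..t, ∑ j, s j r := by
      ext t
      rw [← hdiff]
      ring
    rw [this]
    exact continuous_const.add (intervalIntegral.continuous_primitive
      (fun a b => (integrable_finsetSum _ fun j _ => hint j).intervalIntegrable) 0)
  have hFmono : Monotone F := fun a b hab => by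
    have h := hdiff a b
    have : 0 ≤ ∫ r in a..b, ∑ j, s j r :=
      intervalIntegral.integral_nonneg hab fun r _ => Finset.sum_nonneg fun j _ => hs.nonneg j r
    linarith
  have hWmono : Monotone W := fun k l hkl => Finset.sum_le_sum fun j _ => by
    split_ifs with h1 h2
    · exact le_rfl
    · omega
    · exact hw j
    · exact le_rfl
  have hrel : ∀ k : ℕ, F k ≤ W k := fun k => Finset.sum_le_sum fun j _ => by
    split_ifs with h
    · rw [← hs.integral_eq hL j]
      exact setIntegral_le_integral (hint j) (ae_of_all _ (hs.nonneg j))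
    · refine le_of_eq ?_
      rw [integral_Iic_eq_integral_Iio]
      refine setIntegral_eq_zero_of_forall_eq_zero fun t ht => hs.eq_zero j t fun h' => ?_
      have : (k : ℝ) ≤ (j : ℕ) := by exact_mod_cast not_lt.1 h
      linarith [h'.1, mem_Iio.1 ht]
  have hdead : ∀ k : ℕ, W (k + 1) ≤ F (k + L) := fun k => Finset.sum_le_sum fun j _ => by
    split_ifs with h
    · rw [← hs.integral_eq hL j]
      refine le_of_eq (setIntegral_eq_integral_of_forall_compl_eq_zero
        fun t ht => hs.eq_zero j t fun h' => ht ?_).symm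
      have : ((j : ℕ) : ℝ) ≤ k := by exact_mod_cast Nat.lt_succ_iff.1 h
      exact h'.2.trans (by linarith)
    · exact integral_nonneg (hs.nonneg j)
  -- A time at which the work `W k` is done. It depends on `k` through `W k` only, hence is monotone
  -- in `k` even where `F` is constant. Clamping it to a window does not change the value of `F`.
  set τ : ℕ → ℝ := fun k => Function.invFun F (W k) with hτdef
  have hτ : ∀ k, F (τ k) = W k := fun k => by
    refine Function.invFun_eq (mem_range_of_exists_le_of_exists_ge hFcont ⟨(0 : ℕ), ?_⟩ ⟨k + L, ?_⟩)
    · exact (hrel 0).trans (hWmono (Nat.zero_le k))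
    · exact (hWmono (Nat.le_succ k)).trans (hdead k)
  have hτmono : Monotone τ := fun k l hkl => by
    rcases (hWmono hkl).eq_or_lt with h | h
    · exact le_of_eq (by simp only [hτdef, h])
    · rw [← hτ k, ← hτ l] at h
      exact (hFmono.reflect_lt h).le
  refine ⟨(fun i => max ((i : ℕ) : ℝ) (min (((i : ℕ) : ℝ) + L) (τ i)),
    fun i => max ((i : ℕ) : ℝ) (min (((i : ℕ) : ℝ) + L) (τ (i + 1)))), ⟨fun i => ⟨?_, ?_, ?_⟩,
    fun i j hij => ?_⟩, fun i => ?_⟩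
  · exact le_max_left _ _
  · exact max_le_max le_rfl (min_le_min le_rfl (hτmono (Nat.le_succ _)))
  · exact max_le (by linarith) (min_le_left _ _)
  · have hij' : ((i : ℕ) : ℝ) ≤ (j : ℕ) := by exact_mod_cast hij.le
    exact max_le_max hij' (min_le_min (by linarith) (hτmono hij))
  · have ha := apply_clamp_eq_of_monotone hFmono (hrel i)
      ((hWmono (Nat.le_succ i)).trans (hdead i)) (hτ i) (by linarith)
    have hb := apply_clamp_eq_of_monotone hFmono ((hrel i).trans (hWmono (Nat.le_succ i)))
      (hdead i) (hτ (i + 1)) (by linarith)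
    have hab : max ((i : ℕ) : ℝ) (min (((i : ℕ) : ℝ) + L) (τ i))
        ≤ max ((i : ℕ) : ℝ) (min (((i : ℕ) : ℝ) + L) (τ (i + 1))) :=
      max_le_max le_rfl (min_le_min le_rfl (hτmono (Nat.le_succ _)))
    have hWi : W (i + 1) - W i = w i := by
      rw [hW, ← Finset.sum_sub_distrib, Finset.sum_eq_single i]
      · simp
      · intro j _ hj
        have : (j : ℕ) ≠ i := fun h => hj (Fin.ext h)
        split_ifs <;> first | omega | simp
      · simp
    have hd := hdiff (max ((i : ℕ) : ℝ) (min (((i : ℕ) : ℝ) + L) (τ i)))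
      (max ((i : ℕ) : ℝ) (min (((i : ℕ) : ℝ) + L) (τ (i + 1))))
    rw [ha, hb, hWi, intervalIntegral.integral_of_le hab] at hd
    rw [hd, ofReal_integral_eq_lintegral_ofReal
      (integrable_finsetSum _ fun j _ => hint j).restrict
      (ae_of_all _ fun t => Finset.sum_nonneg fun j _ => hs.nonneg j t)]
    exact lintegral_congr fun t =>
      (ENNReal.ofReal_sum_of_nonneg fun j _ => hs.nonneg j t).symm

theorem orderedTimes_pairwise_disjoint {x : (Fin n → ℝ) × (Fin n → ℝ)}
    (hx : x ∈ orderedTimes n L) :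
    Pairwise (Function.onFun Disjoint fun i => Ioc (x.1 i) (x.2 i)) := by
  intro i j hij
  rw [Function.onFun, Set.disjoint_left]
  intro t hi hj
  rcases lt_or_gt_of_ne hij with h | h
  · linarith [hx.2 i j h, hi.2, hj.1]
  · linarith [hx.2 j i h, hj.2, hi.1]

/-- Every feasible schedule is at least as expensive as some first-in-first-out schedule. -/
theorem IsFeasible.exists_orderedCost_le (hs : IsFeasible L w s) (hL : 0 ≤ L) {α : ℝ}
    (hα : 1 < α) :
    ∃ x ∈ orderedTimes n L,
      orderedCost α w x ≤ ∫⁻ t, (∑ j, ENNReal.ofReal (s j t)) ^ α := by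
  obtain ⟨x, hx, hwork⟩ := hs.exists_orderedTimes hL
  refine ⟨x, hx, ?_⟩
  calc orderedCost α w x
      ≤ ∑ i, ∫⁻ t in Ioc (x.1 i) (x.2 i), (∑ j, ENNReal.ofReal (s j t)) ^ α := by
        refine Finset.sum_le_sum fun i _ => ?_
        have h := rpow_mul_rpow_le_setLIntegral hα hs.measurable_total
          (A := Ioc (x.1 i) (x.2 i)) (by simp)
        rwa [hwork i, Real.volume_Ioc] at h
    _ = ∫⁻ t in ⋃ i, Ioc (x.1 i) (x.2 i), (∑ j, ENNReal.ofReal (s j t)) ^ α := by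
        rw [lintegral_iUnion (fun i => measurableSet_Ioc) (orderedTimes_pairwise_disjoint hx),
          tsum_fintype]
    _ ≤ _ := setLIntegral_le_lintegral _ _

theorem lintegral_ofReal_indicator {a b c : ℝ} :
    ∫⁻ t, ENNReal.ofReal ((Icc a b).indicator (fun _ => c) t)
      = ENNReal.ofReal c * ENNReal.ofReal (b - a) := by
  have : ∀ t, ENNReal.ofReal ((Icc a b).indicator (fun _ => c) t)
      = (Icc a b).indicator (fun _ => ENNReal.ofReal c) t := fun t => by
    by_cases h : t ∈ Icc a b <;> simp [h]
  simp_rw [this]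
  rw [lintegral_indicator_const measurableSet_Icc, Real.volume_Icc]

theorem uniformPlan_isFeasible (hL : 0 ≤ L) (hw : ∀ i, 0 ≤ w i)
    {x : (Fin n → ℝ) × (Fin n → ℝ)} (hx : x ∈ orderedTimes n L)
    (hx0 : ∀ i, x.1 i = x.2 i → w i = 0) : IsFeasible L w (uniformPlan w x).schedule := by
  have hc : ∀ i, 0 ≤ w i / (x.2 i - x.1 i) := fun i =>
    div_nonneg (hw i) (sub_nonneg.2 (hx.1 i).2.1)
  refine IsFeasible.of_lintegral hL hw (fun i => measurable_const.indicator measurableSet_Icc)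
    (fun i t => indicator_nonneg (fun _ _ => hc i) t) (fun i t ht => indicator_of_notMem ?_ _)
    fun i => ?_
  · exact fun h => ht ⟨(hx.1 i).1.trans h.1, h.2.trans (hx.1 i).2.2⟩
  · refine lintegral_ofReal_indicator.trans ?_
    simp only [uniformPlan]
    rw [← ENNReal.ofReal_mul (hc i)]
    congr 1
    rcases eq_or_ne (x.1 i) (x.2 i) with h | h
    · rw [hx0 i h]
      simp
    · exact div_mul_cancel₀ _ (sub_ne_zero.2 h.symm)

theorem lintegral_uniformPlan {x : (Fin n → ℝ) × (Fin n → ℝ)}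
    (hx : x ∈ orderedTimes n L) (hx0 : ∀ i, x.1 i = x.2 i → w i = 0) {α : ℝ} (hα : 1 < α) :
    ∫⁻ t, (∑ i, ENNReal.ofReal ((uniformPlan w x).schedule i t)) ^ α = orderedCost α w x := by
  have hα0 : 0 < α := by linarith
  set c : Fin n → ENNReal := fun i => ENNReal.ofReal (w i / (x.2 i - x.1 i)) with hc
  have hae : ∀ i : Fin n, (fun t => ENNReal.ofReal ((uniformPlan w x).schedule i t)) =ᵐ[volume]
      (Ioc (x.1 i) (x.2 i)).indicator (fun _ => c i) := fun i => by
    have : (fun t => ENNReal.ofReal ((uniformPlan w x).schedule i t))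
        = (Icc (x.1 i) (x.2 i)).indicator (fun _ => c i) := by
      ext t
      by_cases h : t ∈ Icc (x.1 i) (x.2 i) <;> simp [h, Plan.schedule, uniformPlan, hc]
    rw [this]
    exact indicator_ae_eq_of_ae_eq_set Ioc_ae_eq_Icc.symm
  calc _ = ∫⁻ t, (∑ i, (Ioc (x.1 i) (x.2 i)).indicator (fun _ => c i) t) ^ α := by
        refine lintegral_congr_ae ?_
        filter_upwards [eventually_countable_forall.2 hae] with t ht
        simp_rw [ht]
    _ = ∫⁻ t, ∑ i, (Ioc (x.1 i) (x.2 i)).indicator (fun _ => c i ^ α) t := by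
        refine lintegral_congr fun t => ?_
        rw [sum_rpow_of_unique hα0]
        · refine Finset.sum_congr rfl fun i _ => ?_
          by_cases h : t ∈ Ioc (x.1 i) (x.2 i)
          · rw [indicator_of_mem h, indicator_of_mem h]
          · rw [indicator_of_notMem h, indicator_of_notMem h, ENNReal.zero_rpow_of_pos hα0]
        · intro i j hi hj
          by_contra hij
          exact (Set.disjoint_left.1 (orderedTimes_pairwise_disjoint hx hij))
            (mem_of_indicator_ne_zero hi) (mem_of_indicator_ne_zero hj)
    _ = ∑ i, c i ^ α * ENNReal.ofReal (x.2 i - x.1 i) := by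
        rw [lintegral_finsetSum _ fun i _ => measurable_const.indicator measurableSet_Ioc]
        simp_rw [lintegral_indicator_const measurableSet_Ioc, Real.volume_Ioc]
    _ = _ := by
        refine Finset.sum_congr rfl fun i _ => ?_
        rcases (hx.1 i).2.1.eq_or_lt with h | h
        · simp [hc, hx0 i h, ENNReal.zero_rpow_of_pos hα0]
        · have hpos : 0 < x.2 i - x.1 i := sub_pos.2 h
          have hne : ENNReal.ofReal (x.2 i - x.1 i) ≠ 0 := by simpa using hpos
          simp only [hc]
          rw [ENNReal.ofReal_div_of_pos hpos, ENNReal.div_rpow_of_nonneg _ _ hα0.le, div_eq_mul_inv,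
            ← ENNReal.rpow_neg, mul_assoc]
          congr 1
          nth_rewrite 2 [← ENNReal.rpow_one (ENNReal.ofReal (x.2 i - x.1 i))]
          rw [← ENNReal.rpow_add _ _ hne ENNReal.ofReal_ne_top]
          congr 1
          ring

theorem eq_zero_of_orderedCost_ne_top (hw : ∀ i, 0 ≤ w i) {x : (Fin n → ℝ) × (Fin n → ℝ)}
    {α : ℝ} (hα : 1 < α) (hx : orderedCost α w x ≠ ⊤) (i : Fin n) (hi : x.1 i = x.2 i) :
    w i = 0 := by
  by_contra h
  have hpos : 0 < w i := lt_of_le_of_ne (hw i) (Ne.symm h)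
  refine hx (ENNReal.sum_eq_top.2 ⟨i, Finset.mem_univ _, ?_⟩)
  rw [hi, sub_self, ENNReal.ofReal_zero, ENNReal.zero_rpow_of_neg (by linarith)]
  refine ENNReal.mul_top (ne_of_gt (ENNReal.rpow_pos (by simpa using hpos) ENNReal.ofReal_ne_top))

/-- Finding an optimal schedule amounts to minimizing a continuous function on a compact set. -/
theorem exists_isNormalizedOptimal {α L T : ℝ} (hα : 1 < α) (hL : 0 < L)
    (hT : ∀ i : Fin n, ((i : ℕ) : ℝ) + L ≤ T) (hw : ∀ i, 0 ≤ w i) :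
    ∃ p, IsNormalizedOptimal α L T w p := by
  have hα0 : 0 < α := by linarith
  -- The schedule that runs each job during its whole window shows that the minimum is finite.
  set s₀ : Schedule n := fun i =>
    (Icc ((i : ℕ) : ℝ) (((i : ℕ) : ℝ) + L)).indicator (fun _ => w i / L) with hs₀
  have hfeas : IsFeasible L w s₀ := by
    refine IsFeasible.of_lintegral hL.le hw (fun i => measurable_const.indicator measurableSet_Icc)
      (fun i t => indicator_nonneg (fun _ _ => div_nonneg (hw i) hL.le) t)
      (fun i t ht => indicator_of_notMem ht _) fun i => lintegral_ofReal_indicator.trans ?_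
    rw [← ENNReal.ofReal_mul (div_nonneg (hw i) hL.le), add_sub_cancel_left,
      div_mul_cancel₀ _ hL.ne']
  have hfin : ∫⁻ t, (∑ j, ENNReal.ofReal (s₀ j t)) ^ α ≠ ⊤ := by
    have hb : ∀ t, (∑ j, ENNReal.ofReal (s₀ j t)) ^ α
        ≤ (∑ j : Fin n, (Icc ((j : ℕ) : ℝ) (((j : ℕ) : ℝ) + L)).indicator
            (fun _ => ENNReal.ofReal (w j / L)) t) ^ α := fun t => by
      gcongr with j
      by_cases h : t ∈ Icc ((j : ℕ) : ℝ) (((j : ℕ) : ℝ) + L) <;> simp [hs₀, h]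
    refine ne_top_of_le_ne_top ?_ ((lintegral_mono hb).trans
      (lintegral_sum_window_rpow_le hα (Nat.le_ceil L) _))
    refine ENNReal.mul_ne_top (ENNReal.mul_ne_top ?_ ENNReal.ofReal_ne_top)
      (ENNReal.sum_ne_top.2 fun i _ => ?_)
    · exact ENNReal.rpow_ne_top_of_nonneg (by linarith) (ENNReal.natCast_ne_top _)
    · exact ENNReal.rpow_ne_top_of_nonneg hα0.le ENNReal.ofReal_ne_top
  obtain ⟨x₀, hx₀, hcost₀⟩ := hfeas.exists_orderedCost_le hL.le hα
  have hcompact : IsCompact (orderedTimes n L) := by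
    refine IsCompact.of_isClosed_subset
      (isCompact_Icc (a := ((fun i : Fin n => ((i : ℕ) : ℝ)), fun i : Fin n => ((i : ℕ) : ℝ)))
        (b := ((fun i : Fin n => ((i : ℕ) : ℝ) + L), fun i : Fin n => ((i : ℕ) : ℝ) + L))) ?_ ?_
    · have : orderedTimes n L = (⋂ i : Fin n, {x | ((i : ℕ) : ℝ) ≤ x.1 i} ∩
          ({x | x.1 i ≤ x.2 i} ∩ {x | x.2 i ≤ ((i : ℕ) : ℝ) + L})) ∩
          ⋂ (i : Fin n) (j : Fin n) (_ : i < j), {x | x.2 i ≤ x.1 j} := by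
        ext x
        simp [orderedTimes]
      rw [this]
      refine IsClosed.inter (isClosed_iInter fun i => ?_)
        (isClosed_iInter fun i => isClosed_iInter fun j => isClosed_iInter fun _ => ?_)
      · exact (isClosed_le (by fun_prop) (by fun_prop)).inter
          ((isClosed_le (by fun_prop) (by fun_prop)).inter
            (isClosed_le (by fun_prop) (by fun_prop)))
      · exact isClosed_le (by fun_prop) (by fun_prop)
    · intro x hx
      exact ⟨⟨fun i => (hx.1 i).1, fun i => (hx.1 i).1.trans (hx.1 i).2.1⟩,
        ⟨fun i => (hx.1 i).2.1.trans (hx.1 i).2.2, fun i => (hx.1 i).2.2⟩⟩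
  have hcont : Continuous (orderedCost α w) := by
    refine continuous_finsetSum _ fun i _ => ?_
    refine (ENNReal.continuous_const_mul
      (ENNReal.rpow_ne_top_of_nonneg hα0.le ENNReal.ofReal_ne_top)).comp
      (ENNReal.continuous_rpow_const.comp (ENNReal.continuous_ofReal.comp ?_))
    fun_prop
  obtain ⟨x, hx, hmin⟩ := hcompact.exists_isMinOn ⟨x₀, hx₀⟩ hcont.continuousOn
  have hxtop : orderedCost α w x ≠ ⊤ :=
    ne_top_of_le_ne_top hfin ((hmin hx₀).trans hcost₀)
  have hx0 := eq_zero_of_orderedCost_ne_top hw hα hxtop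
  have hf := uniformPlan_isFeasible hL.le hw hx hx0
  refine ⟨uniformPlan w x, fun i => (hx.1 i).1, fun i => (hx.1 i).2.1, fun i => (hx.1 i).2.2,
    fun i j hij => ?_, hf, le_antisymm ?_ (hf.opt_le α T)⟩
  · exact (orderedTimes_pairwise_disjoint hx hij).mono Ioo_subset_Ioc_self Ioo_subset_Ioc_self
  · rw [hf.energy_eq hα0 hT, lintegral_uniformPlan hx hx0 hα]
    refine le_iInf₂ fun s hs => ?_
    obtain ⟨y, hy, hle⟩ := hs.exists_orderedCost_le hL.le hα
    rw [hs.energy_eq hα0 hT]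
    exact (hmin hy).trans hle

end Fifo

/-! ### Stability of the optimum -/

section Stability

variable {n : ℕ} {L : ℝ} {w w' : Fin n → ℝ} {s : Schedule n}

/-- Shortening all windows by the factor `θ` costs at most the factor `θ ^ (1 - α)`: in a
first-in-first-out schedule, the time `t` for job `i` is replaced by `i + θ * (t - i)`. These maps
shift later jobs further to the right, so the new intervals do not overlap either. -/
theorem IsFeasible.opt_mul_le (hs : IsFeasible L w s) (hL : 0 ≤ L) {α T θ : ℝ} (hα : 1 < α)
    (hθ : 0 < θ) (hθ1 : θ ≤ 1) (hT : ∀ i : Fin n, ((i : ℕ) : ℝ) + L ≤ T) :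
    opt α (θ * L) T w
      ≤ ENNReal.ofReal θ ^ (1 - α) * ∫⁻ t, (∑ j, ENNReal.ofReal (s j t)) ^ α := by
  have hw := hs.workload_nonneg hL
  have hθL : θ * L ≤ L := mul_le_of_le_one_left hL hθ1
  obtain ⟨x, hx, hcost⟩ := hs.exists_orderedCost_le hL hα
  have hθ0 : ENNReal.ofReal θ ≠ 0 := by simpa using hθ
  set y : (Fin n → ℝ) × (Fin n → ℝ) :=
    (fun i => (1 - θ) * ((i : ℕ) : ℝ) + θ * x.1 i, fun i => (1 - θ) * ((i : ℕ) : ℝ) + θ * x.2 i)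
    with hy
  have hyx : orderedCost α w y = ENNReal.ofReal θ ^ (1 - α) * orderedCost α w x := by
    unfold orderedCost
    rw [Finset.mul_sum]
    refine Finset.sum_congr rfl fun i _ => ?_
    have : y.2 i - y.1 i = θ * (x.2 i - x.1 i) := by
      simp only [hy]
      ring
    rw [this, ENNReal.ofReal_mul hθ.le,
      ENNReal.mul_rpow_of_ne_top ENNReal.ofReal_ne_top ENNReal.ofReal_ne_top]
    ring
  by_cases htop : orderedCost α w x = ⊤
  · rw [htop, top_le_iff] at hcost
    rw [hcost, ENNReal.mul_top (ne_of_gt (ENNReal.rpow_pos (by simpa using hθ)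
      ENNReal.ofReal_ne_top))]
    exact le_top
  · have hymem : y ∈ orderedTimes n (θ * L) := by
      refine ⟨fun i => ?_, fun i j hij => ?_⟩
      · obtain ⟨h1, h2, h3⟩ := hx.1 i
        simp only [hy]
        exact ⟨by nlinarith, by nlinarith, by nlinarith⟩
      · have h := hx.2 i j hij
        have hij' : ((i : ℕ) : ℝ) ≤ (j : ℕ) := by exact_mod_cast hij.le
        simp only [hy]
        nlinarith
    have hy0 : ∀ i, y.1 i = y.2 i → w i = 0 := fun i hi =>
      eq_zero_of_orderedCost_ne_top hw hα htop i (by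
        simpa [hy, hθ.ne'] using hi)
    have hf := uniformPlan_isFeasible (by positivity) hw hymem hy0
    calc _ ≤ energy α T (uniformPlan w y).schedule := hf.opt_le α T
      _ = ENNReal.ofReal θ ^ (1 - α) * orderedCost α w x := by
          rw [hf.energy_eq (by linarith) fun i => by linarith [hT i],
            lintegral_uniformPlan hymem hy0 hα, hyx]
      _ ≤ _ := by gcongr

/-- A schedule for `w` is turned into one for `w'` by slowing down the jobs with too much work and
adding the missing work at uniform speed over the window. -/
theorem IsFeasible.exists_of_workload (hs : IsFeasible L w s) (hL : 0 < L)
    (hw' : ∀ i, 0 ≤ w' i) :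
    ∃ s' : Schedule n, IsFeasible L w' s' ∧ ∀ i t, ENNReal.ofReal (s' i t) ≤
      ENNReal.ofReal (s i t) + (Icc ((i : ℕ) : ℝ) (((i : ℕ) : ℝ) + L)).indicator
        (fun _ => ENNReal.ofReal (|w i - w' i| / L)) t := by
  have hw := hs.workload_nonneg hL.le
  have hk : ∀ i, 0 ≤ min 1 (w' i / w i) := fun i =>
    le_min zero_le_one (div_nonneg (hw' i) (hw i))
  have hm : ∀ i, 0 ≤ max 0 (w' i - w i) / L := fun i => div_nonneg (le_max_left _ _) hL.le
  have hind : ∀ (i : Fin n) t, 0 ≤ (Icc ((i : ℕ) : ℝ) (((i : ℕ) : ℝ) + L)).indicator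
      (fun _ => max 0 (w' i - w i) / L) t := fun i t => indicator_nonneg (fun _ _ => hm i) t
  refine ⟨fun i t => min 1 (w' i / w i) * s i t +
    (Icc ((i : ℕ) : ℝ) (((i : ℕ) : ℝ) + L)).indicator (fun _ => max 0 (w' i - w i) / L) t,
    IsFeasible.of_lintegral hL.le hw' (fun i => ?_) (fun i t => ?_) (fun i t ht => ?_)
      (fun i => ?_), fun i t => ?_⟩
  · exact ((hs.measurable i).const_mul _).add (measurable_const.indicator measurableSet_Icc)
  · exact add_nonneg (mul_nonneg (hk i) (hs.nonneg i t)) (hind i t)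
  · rw [hs.eq_zero i t ht, indicator_of_notMem ht, mul_zero, add_zero]
  · have h1 : ∀ t, ENNReal.ofReal (min 1 (w' i / w i) * s i t +
        (Icc ((i : ℕ) : ℝ) (((i : ℕ) : ℝ) + L)).indicator (fun _ => max 0 (w' i - w i) / L) t)
        = ENNReal.ofReal (min 1 (w' i / w i)) * ENNReal.ofReal (s i t) + ENNReal.ofReal
        ((Icc ((i : ℕ) : ℝ) (((i : ℕ) : ℝ) + L)).indicator
          (fun _ => max 0 (w' i - w i) / L) t) := fun t => by
      rw [ENNReal.ofReal_add (mul_nonneg (hk i) (hs.nonneg i t)) (hind i t),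
        ENNReal.ofReal_mul (hk i)]
    simp_rw [h1]
    rw [lintegral_add_left ((hs.measurable_ofReal i).const_mul _),
      lintegral_const_mul _ (hs.measurable_ofReal i), hs.lintegral_eq hL.le,
      lintegral_ofReal_indicator, add_sub_cancel_left, ← ENNReal.ofReal_mul (hk i),
      ← ENNReal.ofReal_mul (hm i), ← ENNReal.ofReal_add (mul_nonneg (hk i) (hw i))
        (mul_nonneg (hm i) hL.le), div_mul_cancel₀ _ hL.ne']
    congr 1
    rcases (hw i).eq_or_lt with h | h
    · simp [← h, hw' i]
    · rw [min_mul_of_nonneg _ _ h.le, one_mul, div_mul_cancel₀ _ h.ne']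
      rcases le_total (w i) (w' i) with h' | h'
      · rw [min_eq_left h', max_eq_right (by linarith)]
        ring
      · rw [min_eq_right h', max_eq_left (by linarith)]
        ring
  · have h1 : ENNReal.ofReal (min 1 (w' i / w i) * s i t) ≤ ENNReal.ofReal (s i t) :=
      ENNReal.ofReal_le_ofReal (mul_le_of_le_one_left (hs.nonneg i t) (min_le_left _ _))
    refine ENNReal.ofReal_add_le.trans (add_le_add h1 ?_)
    by_cases h : t ∈ Icc ((i : ℕ) : ℝ) (((i : ℕ) : ℝ) + L)
    · rw [indicator_of_mem h, indicator_of_mem h]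
      refine ENNReal.ofReal_le_ofReal (div_le_div_of_nonneg_right ?_ hL.le)
      exact max_le (abs_nonneg _) (by rw [abs_sub_comm]; exact le_abs_self _)
    · rw [indicator_of_notMem h, indicator_of_notMem h, ENNReal.ofReal_zero]

/-- The energy of spreading each error uniformly over a window of length `θ * D`. -/
theorem lintegral_error_rpow_le {D : ℕ} (hD : 1 ≤ D) {α θ : ℝ} (hα : 1 < α) (hθ : 0 < θ)
    (hθ1 : θ ≤ 1) :
    ∫⁻ t, (∑ i : Fin n, (Icc ((i : ℕ) : ℝ) (((i : ℕ) : ℝ) + θ * D)).indicator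
        (fun _ => ENNReal.ofReal (|w i - w' i| / (θ * D))) t) ^ α
      ≤ ENNReal.ofReal θ ^ (1 - α) * ENNReal.ofReal (predErr α w w') := by
  have hα0 : 0 < α := by linarith
  have hD0 : (0 : ℝ) < D := by exact_mod_cast hD
  have hL : 0 < θ * D := mul_pos hθ hD0
  refine (lintegral_sum_window_rpow_le hα (mul_le_of_le_one_left hD0.le hθ1) _).trans
    (le_of_eq ?_)
  unfold predErr
  rw [ENNReal.ofReal_sum_of_nonneg fun i _ => by positivity, Finset.mul_sum, Finset.mul_sum]
  refine Finset.sum_congr rfl fun i _ => ?_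
  rw [← ENNReal.ofReal_natCast D, ENNReal.ofReal_rpow_of_pos hD0,
    ENNReal.ofReal_rpow_of_nonneg (by positivity) hα0.le, ENNReal.ofReal_rpow_of_pos hθ,
    ← ENNReal.ofReal_mul (by positivity), ← ENNReal.ofReal_mul (by positivity),
    ← ENNReal.ofReal_mul (by positivity), Real.div_rpow (abs_nonneg _) hL.le,
    Real.mul_rpow hθ.le hD0.le, Real.rpow_sub_one hD0.ne', Real.rpow_sub hθ, Real.rpow_one]
  congr 1
  have h1 : (D : ℝ) ^ α ≠ 0 := (Real.rpow_pos_of_pos hD0 α).ne'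
  have h2 : θ ^ α ≠ 0 := (Real.rpow_pos_of_pos hθ α).ne'
  field_simp

/-- Comparison of the optimum for `w'` and shortened windows with a schedule for `w`. -/
theorem IsFeasible.opt_mul_le_of_workload {D : ℕ} (hD : 1 ≤ D) (hs : IsFeasible D w s)
    (hw' : ∀ i, 0 ≤ w' i) {α T θ lam mu : ℝ} (hα : 1 < α) (hθ : 0 < θ) (hθ1 : θ ≤ 1)
    (hl : 0 < lam) (hm : 0 < mu) (hlm : lam + mu = 1)
    (hT : ∀ i : Fin n, ((i : ℕ) : ℝ) + D ≤ T) :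
    opt α (θ * D) T w' ≤ ENNReal.ofReal θ ^ (1 - α) *
      (ENNReal.ofReal lam ^ (1 - α) * energy α T s
        + ENNReal.ofReal mu ^ (1 - α) * ENNReal.ofReal (predErr α w w')) := by
  have hD0 : (0 : ℝ) < D := by exact_mod_cast hD
  obtain ⟨s', hs', hle⟩ := hs.exists_of_workload hD0 hw'
  refine (hs'.opt_mul_le hD0.le hα hθ hθ1 hT).trans ?_
  gcongr
  have herr := lintegral_error_rpow_le (w := w) (w' := w') hD hα one_pos le_rfl
  rw [one_mul, ENNReal.ofReal_one, ENNReal.one_rpow, one_mul] at herr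
  calc _ ≤ ∫⁻ t, ((∑ i, ENNReal.ofReal (s i t)) +
        ∑ i : Fin n, (Icc ((i : ℕ) : ℝ) (((i : ℕ) : ℝ) + D)).indicator
          (fun _ => ENNReal.ofReal (|w i - w' i| / D)) t) ^ α := by
        refine lintegral_mono fun t => ?_
        dsimp only
        rw [← Finset.sum_add_distrib]
        gcongr with i
        exact hle i t
    _ ≤ _ := lintegral_add_rpow_le hα hl hm hlm hs.measurable_total
        (Finset.measurable_sum _ fun i _ => measurable_const.indicator measurableSet_Icc)
    _ ≤ _ := by
        rw [hs.energy_eq (by linarith) hT]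
        gcongr

/-- An affine bound in the energy of each feasible schedule carries over to the optimum. -/
theorem le_mul_opt_add {α T : ℝ} {X A B : ENNReal} (hA0 : A ≠ 0) (hA : A ≠ ⊤)
    (h : ∀ s : Schedule n, IsFeasible L w s → X ≤ A * energy α T s + B) :
    X ≤ A * opt α L T w + B := by
  rw [← tsub_le_iff_right, ← ENNReal.div_le_iff' hA0 hA]
  refine le_iInf₂ fun s hs => ?_
  rw [ENNReal.div_le_iff' hA0 hA, tsub_le_iff_right]
  exact h s hs

end Stability

/-! ### Convolution of schedules -/

section Convolution

variable {n : ℕ} {L h : ℝ} {w : Fin n → ℝ} {s : Schedule n}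

theorem IsFeasible.ofReal_convolve (hs : IsFeasible L w s) (hL : 0 ≤ L) (hh : 0 < h) (i : Fin n)
    (t : ℝ) : ENNReal.ofReal (convolve h (s i) t)
      = movingAverage h (fun r => ENNReal.ofReal (s i r)) t :=
  SpeedScaling.ofReal_convolve hh (hs.nonneg i) (hs.integrable_line hL i) t

theorem IsFeasible.convolve (hs : IsFeasible L w s) (hL : 0 ≤ L) (hh : 0 < h) :
    IsFeasible (L + h) w fun i => convolve h (s i) := by
  refine IsFeasible.of_lintegral (by linarith) (hs.workload_nonneg hL) (fun i => ?_)
    (fun i t => ?_) (fun i t ht => ?_) (fun i => ?_)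
  · have hc := intervalIntegral.continuous_primitive
      (fun a b => (hs.integrable_line hL i).intervalIntegrable (a := a) (b := b)) 0
    have : SpeedScaling.convolve h (s i) = fun t =>
        (1 / h) * ((∫ r in (0 : ℝ)..t, s i r) - ∫ r in (0 : ℝ)..(t - h), s i r) := by
      ext t
      unfold SpeedScaling.convolve
      rw [intervalIntegral.integral_interval_sub_left
        (hs.integrable_line hL i).intervalIntegrable (hs.integrable_line hL i).intervalIntegrable]
    rw [this]
    exact (continuous_const.mul (hc.sub (hc.comp (continuous_sub_right h)))).measurable
  · exact mul_nonneg (by positivity)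
      (intervalIntegral.integral_nonneg (by linarith) fun r _ => hs.nonneg i r)
  · unfold SpeedScaling.convolve
    rw [intervalIntegral.integral_of_le (by linarith), integral_Ioc_eq_integral_Ioo,
      setIntegral_eq_zero_of_forall_eq_zero, mul_zero]
    exact fun r hr => hs.eq_zero i r fun h' =>
      ht ⟨by linarith [h'.1, hr.2], by linarith [h'.2, hr.1]⟩
  · simp_rw [hs.ofReal_convolve hL hh]
    rw [lintegral_movingAverage hh (hs.measurable_ofReal i), hs.lintegral_eq hL]

theorem IsFeasible.lintegral_convolve_le (hs : IsFeasible L w s) (hL : 0 ≤ L) (hh : 0 < h)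
    {α : ℝ} (hα : 1 < α) :
    ∫⁻ t, (∑ i, ENNReal.ofReal (SpeedScaling.convolve h (s i) t)) ^ α
      ≤ ∫⁻ t, (∑ i, ENNReal.ofReal (s i t)) ^ α := by
  simp_rw [hs.ofReal_convolve hL hh, sum_movingAverage _ _ hs.measurable_ofReal]
  exact lintegral_movingAverage_rpow_le hα hh hs.measurable_total

/-- Convolution bounds the speed of each job by `w i / h`, whatever the schedule. Any other
schedule `s'` does all the work of the jobs that are active at time `t` within `[t - D, t + D]`, so
the convolved schedule is dominated by a multiple of the moving average of the speed of `s'`. -/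
theorem IsFeasible.lintegral_convolve_le_of_isFeasible (hs : IsFeasible L w s) (hL : 0 ≤ L)
    (hh : 0 < h) {D : ℝ} (hD : L + h = D) {s' : Schedule n} (hs' : IsFeasible D w s') {α : ℝ}
    (hα : 1 < α) :
    ∫⁻ t, (∑ i, ENNReal.ofReal (SpeedScaling.convolve h (s i) t)) ^ α
      ≤ ENNReal.ofReal (2 * D / h) ^ α * ∫⁻ t, (∑ i, ENNReal.ofReal (s' i t)) ^ α := by
  have hD0 : 0 < D := by linarith
  have hconv : IsFeasible D w fun i => SpeedScaling.convolve h (s i) := hD ▸ hs.convolve hL hh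
  have hα0 : 0 ≤ α := by linarith
  have hpt : ∀ i t, ENNReal.ofReal (SpeedScaling.convolve h (s i) t)
      ≤ ENNReal.ofReal (2 * D / h) *
        movingAverage (2 * D) (fun r => ENNReal.ofReal (s' i r)) (t + D) := by
    intro i t
    by_cases ht : t ∈ Icc ((i : ℕ) : ℝ) (((i : ℕ) : ℝ) + D)
    · have hall : ∫⁻ r in Ioc (t + D - 2 * D) (t + D), ENNReal.ofReal (s' i r)
          = ENNReal.ofReal (w i) := by
        rw [← hs'.lintegral_eq hD0.le i, setLIntegral_congr Ioc_ae_eq_Icc]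
        refine setLIntegral_eq_of_support_subset fun r hr => ?_
        by_contra hr'
        refine hr ?_
        dsimp only
        rw [hs'.eq_zero i r fun h' => hr' ⟨by linarith [ht.2, h'.1], by linarith [ht.1, h'.2]⟩,
          ENNReal.ofReal_zero]
      have h2D : ENNReal.ofReal (2 * D) ≠ 0 := by simpa using hD0
      rw [hs.ofReal_convolve hL hh]
      unfold movingAverage
      rw [hall, ENNReal.ofReal_div_of_pos hh, div_eq_mul_inv, ← hs.lintegral_eq hL i]
      calc _ ≤ (ENNReal.ofReal h)⁻¹ * ∫⁻ r, ENNReal.ofReal (s i r) := by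
            gcongr
            exact Measure.restrict_le_self
        _ = (ENNReal.ofReal (2 * D) * (ENNReal.ofReal (2 * D))⁻¹) *
              ((ENNReal.ofReal h)⁻¹ * ∫⁻ r, ENNReal.ofReal (s i r)) := by
            rw [ENNReal.mul_inv_cancel h2D ENNReal.ofReal_ne_top, one_mul]
        _ = _ := by ring
    · rw [hconv.eq_zero i t ht, ENNReal.ofReal_zero]
      exact zero_le
  calc _ ≤ ∫⁻ t, ENNReal.ofReal (2 * D / h) ^ α * movingAverage (2 * D)
        (fun r => ∑ i, ENNReal.ofReal (s' i r)) (t + D) ^ α := by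
        refine lintegral_mono fun t => ?_
        dsimp only
        rw [← ENNReal.mul_rpow_of_nonneg _ _ hα0, ← sum_movingAverage _ _ hs'.measurable_ofReal,
          Finset.mul_sum]
        gcongr with i
        exact hpt i t
    _ = ENNReal.ofReal (2 * D / h) ^ α * ∫⁻ t, movingAverage (2 * D)
        (fun r => ∑ i, ENNReal.ofReal (s' i r)) t ^ α := by
        rw [lintegral_const_mul' _ _ (ENNReal.rpow_ne_top_of_nonneg hα0 ENNReal.ofReal_ne_top),
          lintegral_add_right_eq_self (fun t => movingAverage (2 * D)
            (fun r => ∑ i, ENNReal.ofReal (s' i r)) t ^ α)]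
    _ ≤ _ := by
        gcongr _ * ?_
        exact lintegral_movingAverage_rpow_le hα (by linarith) hs'.measurable_total

end Convolution

/-! ### The algorithm LAS -/

section Las

variable {n : ℕ} {L α T : ℝ} {wreal wpred : Fin n → ℝ} {p : Plan n}

/-- The schedule of LAS-Trust, which LAS convolves. -/
noncomputable def trust (L : ℝ) (wpred : Fin n → ℝ) (p : Plan n) (wreal : Fin n → ℝ) : Schedule n :=
  fun i => trustSpeed L ((i : ℕ) : ℝ) (p.a i) (p.b i) (p.c i) (wreal i) (wpred i)

theorem IsNormalizedOptimal.speed_nonneg (hp : IsNormalizedOptimal α L T wpred p) (i : Fin n) :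
    0 ≤ p.c i := by
  have h := hp.feasible.nonneg i (p.a i)
  rwa [Plan.schedule, indicator_of_mem (left_mem_Icc.2 (hp.start_le_end i))] at h

theorem IsNormalizedOptimal.speed_mul (hp : IsNormalizedOptimal α L T wpred p) (hL : 0 ≤ L)
    (i : Fin n) : p.c i * (p.b i - p.a i) = wpred i := by
  have h := hp.feasible.lintegral_eq hL i
  have hc := hp.speed_nonneg i
  unfold Plan.schedule at h
  rw [lintegral_ofReal_indicator, ← ENNReal.ofReal_mul hc] at h
  exact (ENNReal.ofReal_eq_ofReal_iff (mul_nonneg hc (sub_nonneg.2 (hp.start_le_end i)))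
    (hp.feasible.workload_nonneg hL i)).1 h

theorem IsNormalizedOptimal.trust_isFeasible (hp : IsNormalizedOptimal α L T wpred p) (hL : 0 < L)
    (hreal : ∀ i, 0 ≤ wreal i) : IsFeasible L wreal (trust L wpred p wreal) := by
  have hk : ∀ i, 0 ≤ min (wreal i / (p.b i - p.a i)) (p.c i) := fun i =>
    le_min (div_nonneg (hreal i) (sub_nonneg.2 (hp.start_le_end i))) (hp.speed_nonneg i)
  have hm : ∀ i, 0 ≤ max 0 (wreal i - wpred i) / L := fun i =>
    div_nonneg (le_max_left _ _) hL.le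
  have h1 : ∀ i t, 0 ≤ (Icc (p.a i) (p.b i)).indicator
      (fun _ => min (wreal i / (p.b i - p.a i)) (p.c i)) t := fun i t =>
    indicator_nonneg (fun _ _ => hk i) t
  have h2 : ∀ (i : Fin n) t, 0 ≤ (Icc ((i : ℕ) : ℝ) (((i : ℕ) : ℝ) + L)).indicator
      (fun _ => max 0 (wreal i - wpred i) / L) t := fun i t =>
    indicator_nonneg (fun _ _ => hm i) t
  refine IsFeasible.of_lintegral hL.le hreal (fun i => ?_) (fun i t => ?_) (fun i t ht => ?_)
    (fun i => ?_)
  · exact (measurable_const.indicator measurableSet_Icc).add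
      (measurable_const.indicator measurableSet_Icc)
  · exact add_nonneg (h1 i t) (h2 i t)
  · unfold trust trustSpeed
    rw [indicator_of_notMem ht, indicator_of_notMem, add_zero]
    exact fun h => ht ⟨(hp.le_start i).trans h.1, h.2.trans (hp.end_le i)⟩
  · unfold trust trustSpeed
    simp_rw [ENNReal.ofReal_add (h1 i _) (h2 i _)]
    rw [lintegral_add_left (measurable_const.indicator measurableSet_Icc).ennreal_ofReal,
      lintegral_ofReal_indicator, lintegral_ofReal_indicator, ← ENNReal.ofReal_mul (hk i),
      ← ENNReal.ofReal_mul (hm i), add_sub_cancel_left, div_mul_cancel₀ _ hL.ne',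
      ← ENNReal.ofReal_add (mul_nonneg (hk i) (sub_nonneg.2 (hp.start_le_end i)))
        (le_max_left _ _)]
    congr 1
    have hwork := hp.speed_mul hL.le i
    -- If the interval is a single point, then `wpred i = 0`, and division by zero is harmless.
    have hmin : min (wreal i / (p.b i - p.a i)) (p.c i) * (p.b i - p.a i)
        = min (wreal i) (wpred i) := by
      rcases (hp.start_le_end i).eq_or_lt with h | h
      · rw [← h, sub_self, mul_zero] at hwork
        rw [← h, sub_self, mul_zero, ← hwork, min_eq_right (hreal i)]
      · rw [min_mul_of_nonneg _ _ (sub_nonneg.2 h.le), hwork,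
          div_mul_cancel₀ _ (sub_ne_zero.2 h.ne')]
    rw [hmin]
    rcases le_total (wreal i) (wpred i) with h | h
    · rw [min_eq_left h, max_eq_left (by linarith), add_zero]
    · rw [min_eq_right h, max_eq_right (by linarith)]
      ring

theorem ofReal_trust_le (hL : 0 < L) (i : Fin n) (t : ℝ) :
    ENNReal.ofReal (trust L wpred p wreal i t) ≤ ENNReal.ofReal (p.schedule i t) +
      (Icc ((i : ℕ) : ℝ) (((i : ℕ) : ℝ) + L)).indicator
        (fun _ => ENNReal.ofReal (|wreal i - wpred i| / L)) t := by
  unfold trust trustSpeed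
  refine ENNReal.ofReal_add_le.trans (add_le_add (ENNReal.ofReal_le_ofReal ?_) ?_)
  · exact indicator_le_indicator (min_le_right _ _)
  · by_cases h : t ∈ Icc ((i : ℕ) : ℝ) (((i : ℕ) : ℝ) + L)
    · rw [indicator_of_mem h, indicator_of_mem h]
      exact ENNReal.ofReal_le_ofReal (div_le_div_of_nonneg_right
        (max_le (abs_nonneg _) (le_abs_self _)) hL.le)
    · rw [indicator_of_notMem h, indicator_of_notMem h, ENNReal.ofReal_zero]

/-- LAS-Trust costs little more than the optimum for the prediction if the prediction is good. -/
theorem IsNormalizedOptimal.lintegral_trust_le {D : ℕ} (hD : 1 ≤ D) {θ lam mu : ℝ}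
    (hp : IsNormalizedOptimal α (θ * D) T wpred p) (hα : 1 < α) (hθ : 0 < θ) (hθ1 : θ ≤ 1)
    (hl : 0 < lam) (hm : 0 < mu) (hlm : lam + mu = 1)
    (hT : ∀ i : Fin n, ((i : ℕ) : ℝ) + D ≤ T) :
    ∫⁻ t, (∑ i, ENNReal.ofReal (trust (θ * D) wpred p wreal i t)) ^ α
      ≤ ENNReal.ofReal lam ^ (1 - α) * opt α (θ * D) T wpred
        + ENNReal.ofReal mu ^ (1 - α) *
          (ENNReal.ofReal θ ^ (1 - α) * ENNReal.ofReal (predErr α wreal wpred)) := by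
  have hD0 : (0 : ℝ) < D := by exact_mod_cast hD
  have hL : 0 < θ * D := mul_pos hθ hD0
  have hLD : θ * D ≤ D := mul_le_of_le_one_left hD0.le hθ1
  calc _ ≤ ∫⁻ t, ((∑ i, ENNReal.ofReal (p.schedule i t)) +
        ∑ i : Fin n, (Icc ((i : ℕ) : ℝ) (((i : ℕ) : ℝ) + θ * D)).indicator
          (fun _ => ENNReal.ofReal (|wreal i - wpred i| / (θ * D))) t) ^ α := by
        refine lintegral_mono fun t => ?_
        dsimp only
        rw [← Finset.sum_add_distrib]
        gcongr with i
        exact ofReal_trust_le hL i t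
    _ ≤ _ := lintegral_add_rpow_le hα hl hm hlm hp.feasible.measurable_total
        (Finset.measurable_sum _ fun i _ => measurable_const.indicator measurableSet_Icc)
    _ ≤ _ := by
        rw [← hp.optimal, hp.feasible.energy_eq (by linarith) fun i => by linarith [hT i]]
        gcongr
        exact lintegral_error_rpow_le hD hα hθ hθ1

end Las

/-! ### The constants -/

/-- Since `((1 + δ) / (1 - δ)) ^ α = 1 + ε`, both `δ` and `1 - δ` can be controlled through
`x = (1 + ε) ^ (1 / α)`, which lies between `1 + log (1 + ε) / α` and `1 + ε`. -/
theorem one_div_lasDelta_le {α ε E : ℝ} (hα : 1 < α) (hε : 0 < ε) (hεE : ε ≤ E) :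
    1 / (lasDelta α ε * (1 - lasDelta α ε)) ≤ (2 + E) ^ 2 * (1 + E) / 2 * (α / ε) := by
  have hα0 : 0 < α := by linarith
  have hx1 : 1 < (1 + ε) ^ (1 / α) := Real.one_lt_rpow (by linarith) (by positivity)
  have hxE : (1 + ε) ^ (1 / α) ≤ 1 + E := by
    calc (1 + ε) ^ (1 / α) ≤ (1 + ε) ^ (1 : ℝ) :=
          Real.rpow_le_rpow_of_exponent_le (by linarith) ((div_le_one hα0).2 hα.le)
      _ ≤ 1 + E := by rw [Real.rpow_one]; linarith
  have hxl : ε / (α * (1 + E)) ≤ (1 + ε) ^ (1 / α) - 1 := by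
    have h1 : ε / (1 + ε) ≤ Real.log (1 + ε) := by
      have := Real.one_sub_inv_le_log_of_pos (by linarith : 0 < 1 + ε)
      calc ε / (1 + ε) = 1 - (1 + ε)⁻¹ := by field_simp; ring
        _ ≤ _ := this
    have h2 : Real.log (1 + ε) * (1 / α) + 1 ≤ (1 + ε) ^ (1 / α) := by
      rw [Real.rpow_def_of_pos (by linarith)]
      exact Real.add_one_le_exp _
    calc ε / (α * (1 + E)) ≤ ε / (α * (1 + ε)) := by gcongr
      _ = ε / (1 + ε) * (1 / α) := by field_simp
      _ ≤ Real.log (1 + ε) * (1 / α) := by gcongr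
      _ ≤ _ := by linarith
  unfold lasDelta
  generalize (1 + ε) ^ (1 / α) = x at *
  have hx0 : 0 < x + 1 := by linarith
  have hE : 0 < 1 + E := by linarith
  have e1 : (x - 1) / (x + 1) * (1 - (x - 1) / (x + 1)) = 2 * (x - 1) / (x + 1) ^ 2 := by
    field_simp
    ring
  rw [e1, one_div_div]
  have hpos : 0 < ε / (α * (1 + E)) := by positivity
  calc (x + 1) ^ 2 / (2 * (x - 1)) ≤ (2 + E) ^ 2 / (2 * (ε / (α * (1 + E)))) := by
        gcongr ?_ ^ 2 / (2 * ?_)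
        linarith
    _ = _ := by field_simp

/-- The weights `1 - δ / 4` and `δ / 4` keep the coefficient of the optimum below `1 + ε`. -/
theorem weights_le_one_add {α δ ε : ℝ} (hα : 1 < α) (hδ : 0 < δ) (hδ1 : δ < 1)
    (hspec : ((1 + δ) / (1 - δ)) ^ α = 1 + ε) :
    (1 - δ / 4) ^ (1 - α) * ((1 - δ) ^ (1 - α) * (1 - δ / 4) ^ (1 - α)) ≤ 1 + ε := by
  have h1 : 0 < 1 - δ / 4 := by linarith
  have h2 : 0 < 1 - δ := by linarith
  have hpos : 0 < (1 - δ / 4) * ((1 - δ) * (1 - δ / 4)) := by positivity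
  rw [← Real.mul_rpow h2.le h1.le, ← Real.mul_rpow h1.le (by positivity), ← neg_sub α,
    Real.rpow_neg hpos.le, ← Real.inv_rpow hpos.le, ← hspec]
  have hbase : ((1 - δ / 4) * ((1 - δ) * (1 - δ / 4)))⁻¹ ≤ (1 + δ) / (1 - δ) := by
    rw [inv_le_comm₀ hpos (by positivity), inv_div, div_le_iff₀ (by linarith)]
    have : 1 ≤ (1 - δ / 4) * (1 - δ / 4) * (1 + δ) := by nlinarith [mul_pos hδ h2]
    nlinarith
  calc _ ≤ ((1 + δ) / (1 - δ)) ^ (α - 1) :=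
        Real.rpow_le_rpow (by positivity) hbase (by linarith)
    _ ≤ _ := Real.rpow_le_rpow_of_exponent_le ((one_le_div h2).2 (by linarith)) (by linarith)

theorem weights_error_le {α δ K : ℝ} (hα : 1 < α) (hδ : 0 < δ) (hδ1 : δ < 1)
    (hK : 11 / (δ * (1 - δ)) ≤ K) :
    (1 - δ / 4) ^ (1 - α) * ((1 - δ) ^ (1 - α) * (δ / 4) ^ (1 - α))
      + (δ / 4) ^ (1 - α) * (1 - δ) ^ (1 - α) ≤ K ^ α := by
  have h1 : 0 < 1 - δ / 4 := by linarith
  have h2 : 0 < 1 - δ := by linarith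
  have hlam : 1 ≤ (1 - δ / 4) ^ (1 - α) :=
    Real.one_le_rpow_of_pos_of_le_one_of_nonpos h1 (by linarith) (by linarith)
  set y := (1 - δ / 4) * ((1 - δ) * (δ / 4)) with hy
  have hpos : 0 < y := by positivity
  have hy1 : 1 ≤ y⁻¹ := by
    rw [one_le_inv₀ hpos]
    exact mul_le_one₀ (by linarith) (by positivity)
      (mul_le_one₀ (by linarith) (by positivity) (by linarith))
  have hyK : 2 * y⁻¹ ≤ K := by
    refine le_trans ?_ hK
    have h34 : 3 / 16 * (δ * (1 - δ)) ≤ y := by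
      have := mul_pos hδ h2
      rw [hy]
      nlinarith
    calc 2 * y⁻¹ ≤ 2 * (3 / 16 * (δ * (1 - δ)))⁻¹ := by gcongr
      _ = 32 / 3 / (δ * (1 - δ)) := by field_simp; norm_num
      _ ≤ _ := by gcongr; norm_num
  have hfirst : (1 - δ / 4) ^ (1 - α) * ((1 - δ) ^ (1 - α) * (δ / 4) ^ (1 - α))
      = (y⁻¹) ^ (α - 1) := by
    rw [← Real.mul_rpow h2.le (by positivity), ← Real.mul_rpow h1.le (by positivity), ← neg_sub α,
      Real.rpow_neg hpos.le, ← Real.inv_rpow hpos.le]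
  calc _ ≤ 2 * (y⁻¹) ^ (α - 1) := by
        rw [← hfirst]
        have : (δ / 4) ^ (1 - α) * (1 - δ) ^ (1 - α)
            ≤ (1 - δ / 4) ^ (1 - α) * ((1 - δ) ^ (1 - α) * (δ / 4) ^ (1 - α)) := by
          rw [mul_comm ((1 - δ) ^ (1 - α))]
          exact le_mul_of_one_le_left (by positivity) hlam
        linarith
    _ ≤ 2 ^ α * (y⁻¹) ^ α := by
        gcongr
        · exact Real.self_le_rpow_of_one_le (by norm_num) hα.le
        · linarith
    _ = (2 * y⁻¹) ^ α := (Real.mul_rpow (by norm_num) (by positivity)).symm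
    _ ≤ _ := Real.rpow_le_rpow (by positivity) hyK (by linarith)

end SpeedScaling

/-- Guarantee of LAS for uniform speed scaling. Jobs are released at the times `0, …, T - D`. -/
theorem mainTheorem1 :
    ∀ E : ℝ, 0 < E → ∃ C : ℝ, 0 < C ∧
      ∀ α : ℝ, 1 < α → ∀ ε : ℝ, 0 < ε → ε ≤ E →
      ∀ D T : ℕ, 1 ≤ D → D ≤ T →
      ∀ wreal wpred : Fin (T - D + 1) → ℝ, (∀ i, 0 ≤ wreal i) → (∀ i, 0 ≤ wpred i) →
        (∃ p : SpeedScaling.Plan (T - D + 1),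
          SpeedScaling.IsNormalizedOptimal α ((1 - SpeedScaling.lasDelta α ε) * D) T wpred p) ∧
        ∀ p : SpeedScaling.Plan (T - D + 1),
          SpeedScaling.IsNormalizedOptimal α ((1 - SpeedScaling.lasDelta α ε) * D) T wpred p →
          SpeedScaling.IsFeasible D wreal (SpeedScaling.las α ε D wpred p wreal) ∧
          SpeedScaling.energy α T (SpeedScaling.las α ε D wpred p wreal) ≤
            min
              (ENNReal.ofReal (1 + ε) * SpeedScaling.opt α D T wreal
                + ENNReal.ofReal ((C * (α / ε)) ^ α * SpeedScaling.predErr α wreal wpred))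
              (ENNReal.ofReal ((C * (α / ε)) ^ α) * SpeedScaling.opt α D T wreal) := by
  intro E hE
  refine ⟨11 * ((2 + E) ^ 2 * (1 + E) / 2), by positivity, ?_⟩
  intro α hα ε hε hεE D T hD hDT wreal wpred hreal hpred
  obtain ⟨hδ, hδ1, hspec⟩ := SpeedScaling.lasDelta_spec hα hε
  have hbound := SpeedScaling.one_div_lasDelta_le hα hε hεE
  have hlas : ∀ p : SpeedScaling.Plan (T - D + 1), SpeedScaling.las α ε D wpred p wreal
      = fun i => SpeedScaling.convolve (SpeedScaling.lasDelta α ε * D)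
        (SpeedScaling.trust ((1 - SpeedScaling.lasDelta α ε) * D) wpred p wreal i) :=
    fun p => rfl
  simp_rw [hlas]
  generalize SpeedScaling.lasDelta α ε = δ at *
  have hα0 : 0 < α := by linarith
  have hD0 : (0 : ℝ) < D := by exact_mod_cast hD
  have hθ : 0 < 1 - δ := by linarith
  have hL : 0 < (1 - δ) * D := mul_pos hθ hD0
  have hh : 0 < δ * D := mul_pos hδ hD0
  have hLh : (1 - δ) * D + δ * D = D := by ring
  have hT : ∀ i : Fin (T - D + 1), ((i : ℕ) : ℝ) + D ≤ T := fun i => by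
    have := i.isLt
    have h : (i : ℕ) + D ≤ T := by omega
    exact_mod_cast h
  have hK : 11 / (δ * (1 - δ)) ≤ 11 * ((2 + E) ^ 2 * (1 + E) / 2) * (α / ε) := by
    rw [div_eq_mul_one_div, mul_assoc 11]
    exact mul_le_mul_of_nonneg_left hbound (by norm_num)
  set K := 11 * ((2 + E) ^ 2 * (1 + E) / 2) * (α / ε) with hKdef
  have hK0 : 0 < K := by positivity
  refine ⟨SpeedScaling.exists_isNormalizedOptimal hα hL (fun i => by linarith [hT i]) hpred,
    fun p hp => ?_⟩
  have htrust := hp.trust_isFeasible hL hreal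
  have hfeas := htrust.convolve hL.le hh
  rw [hLh] at hfeas
  refine ⟨hfeas, le_min ?_ ?_⟩
  · refine SpeedScaling.le_mul_opt_add (by simpa using by linarith) ENNReal.ofReal_ne_top
      fun s hs => ?_
    rw [hfeas.energy_eq hα0 hT]
    refine (htrust.lintegral_convolve_le hL.le hh hα).trans ?_
    have hl : 0 < 1 - δ / 4 := by linarith
    have hm : 0 < δ / 4 := by linarith
    have herr : 0 ≤ SpeedScaling.predErr α wreal wpred :=
      Finset.sum_nonneg fun i _ => Real.rpow_nonneg (abs_nonneg _) _
    have h1 := hp.lintegral_trust_le (wreal := wreal) hD hα hθ (by linarith) hl hm (by ring) hT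
    have h2 := hs.opt_mul_le_of_workload hD hpred hα hθ (by linarith) hl hm (by ring) hT
    have hA := ENNReal.ofReal_le_ofReal (SpeedScaling.weights_le_one_add hα hδ hδ1 hspec)
    have hB := ENNReal.ofReal_le_ofReal (SpeedScaling.weights_error_le hα hδ hδ1 hK)
    rw [ENNReal.ofReal_add (by positivity) (by positivity)] at hB
    rw [ENNReal.ofReal_mul (by positivity), ENNReal.ofReal_mul (by positivity),
      ← ENNReal.ofReal_rpow_of_pos hl, ← ENNReal.ofReal_rpow_of_pos hθ] at hA
    rw [ENNReal.ofReal_mul (by positivity), ENNReal.ofReal_mul (by positivity),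
      ENNReal.ofReal_mul (by positivity), ← ENNReal.ofReal_rpow_of_pos hl,
      ← ENNReal.ofReal_rpow_of_pos hθ, ← ENNReal.ofReal_rpow_of_pos hm] at hB
    rw [ENNReal.ofReal_mul (by positivity)]
    refine (h1.trans (add_le_add_left (mul_le_mul_right h2 _) _)).trans ?_
    refine le_trans (le_of_eq ?_) (add_le_add (mul_le_mul_left hA _) (mul_le_mul_left hB _))
    ring
  · rw [← add_zero (ENNReal.ofReal (K ^ α) * _)]
    refine SpeedScaling.le_mul_opt_add
      (by simpa using Real.rpow_pos_of_pos hK0 α) ENNReal.ofReal_ne_top fun s hs => ?_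
    rw [hfeas.energy_eq hα0 hT, hs.energy_eq hα0 hT, add_zero]
    refine (htrust.lintegral_convolve_le_of_isFeasible hL.le hh hLh hs hα).trans ?_
    gcongr
    rw [← ENNReal.ofReal_rpow_of_pos hK0]
    gcongr
    refine le_trans ?_ hK
    rw [mul_div_mul_right _ _ hD0.ne']
    gcongr
    · norm_num
    · exact mul_le_of_le_one_right hδ.le (by linarith)
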